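/- Let $\gamma$ be an ellipse in the Euclidean plane with foci $F_1,F_2$ (circles, $F_1=F_2$, allowed), and fix an orientation of the plane. At each point $a\in\gamma$ orient the tangent line of $\gamma$ so that $\gamma$ lies on its left. Let $\Gamma$ be an ellipse with the same foci that contains $\gamma$ in its interior, and consider the billiard inside $\Gamma$: a segment $xy$ with $x\neq y$ on $\Gamma$ is followed by the segment $yz$, $z\in\Gamma$, $z\ne y$, whose direction is the reflection of the direction of $xy$ in the tangent line of $\Gamma$ at $y$. Then there is a unique map $T_\Gamma\colon\gamma\to\gamma$, the billiard ball map of $\Gamma$ viewed as a self-map of $\gamma$, with the following property: for every $a\in\gamma$ the oriented tangent line of $\gamma$ at $a$ carries a segment $xy$ of a billiard trajectory $xyz$ in $\Gamma$, and for each such trajectory the oriented line $yz$ is the oriented tangent line of $\gamma$ at $T_\Gamma(a)$. Moreover, there is a cyclic coordinate on $\gamma$, that is, a homeomorphism $x\colon\gamma\to\mathbb R/\mathbb Z$, depending on $\gamma$ only, in which all these maps are shifts: for every $\Gamma$ as above there is a constant $c\in\mathbb R/\mathbb Z$ with $x(T_\Gamma(p))=x(p)+c$ for all $p\in\gamma$.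 If $\Gamma$ and $\Gamma'$ are two ellipses confocal with $\gamma$ that both contain $\gamma$ in their interiors, then the billiard ball maps commute: $T_\Gamma\circ T_{\Gamma'}=T_{\Gamma'}\circ T_\Gamma$. -/

import Mathlib

/-- The Euclidean plane. -/
abbrev Plane : Type := EuclideanSpace ℝ (Fin 2)

/-- The plane is two-dimensional; this makes the signed area form of an orientation available. -/
instance planeFinrank : Fact (Module.finrank ℝ Plane = 2) :=
  ⟨finrank_euclideanSpace_fin⟩

/-- The ellipse with foci `F₁`, `F₂` and sum of focal distances `ℓ` (an honest ellipse if and only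
if `dist F₁ F₂ < ℓ`; a circle if `F₁ = F₂`).  Ellipses with the same `F₁`, `F₂` are confocal. -/
def ellipse (F₁ F₂ : Plane) (ℓ : ℝ) : Set Plane :=
  {P | dist P F₁ + dist P F₂ = ℓ}

/-- The open region bounded by the ellipse `ellipse F₁ F₂ ℓ`. -/
def ellipseInterior (F₁ F₂ : Plane) (ℓ : ℝ) : Set Plane :=
  {P | dist P F₁ + dist P F₂ < ℓ}

/-- The direction of the tangent line of a smooth curve `Γ` at the point `y`: the span of all
limits of rescaled differences `q - y`, with `q ∈ Γ` tending to `y`. -/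
noncomputable def tangentDirection (Γ : Set Plane) (y : Plane) : Submodule ℝ Plane :=
  Submodule.span ℝ (tangentConeAt ℝ Γ y)

/-- The unit vector pointing from `x` to `y` (for `x ≠ y`). -/
noncomputable def unitDirection (x y : Plane) : Plane :=
  ‖y - x‖⁻¹ • (y - x)

/-- `x`, `y`, `z` are successive impact points of a billiard trajectory in the table bounded by
`Γ`: the segment `xy` is reflected at `y` to the segment `yz`, with equal angles of incidence and
reflection.  The billiard ball map sends the oriented line `xy` to the oriented line `yz`. -/
structure IsBilliardTrajectory (Γ : Set Plane) (x y z : Plane) : Prop where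
  left_mem : x ∈ Γ
  mid_mem : y ∈ Γ
  right_mem : z ∈ Γ
  left_ne : x ≠ y
  right_ne : y ≠ z
  reflection_law :
    unitDirection y z = (tangentDirection Γ y).reflection (unitDirection x y)

/-- The oriented line from `x` to `y` is tangent to the convex curve `γ` at the point `a`, in the
positive sense with respect to the orientation `o` of the plane: `γ` lies on its left. -/
structure IsPositivelyTangentAt (o : Orientation ℝ Plane (Fin 2)) (γ : Set Plane)
    (x y a : Plane) : Prop where
  mem_curve : a ∈ γ
  mem_line : a ∈ line[ℝ, x, y]
  tangent : y - x ∈ tangentDirection γ a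
  curve_left : ∀ q ∈ γ, 0 ≤ o.areaForm (y - x) (q - x)

/-- `T : γ → γ` is the billiard ball map of the table bounded by `Γ`, viewed as a self-map of its
caustic `γ`.  Positively oriented tangent lines of `γ` are identified with their tangency points;
the tangent line at `a` does carry a segment `xy` of a billiard trajectory `xyz`, and for every
such trajectory the reflected line `yz` is the tangent line at `T a`. -/
structure IsBilliardBallMap (o : Orientation ℝ Plane (Fin 2)) (γ Γ : Set Plane)
    (T : γ → γ) : Prop where
  exists_trajectory : ∀ a : γ, ∃ x y z : Plane,
    IsBilliardTrajectory Γ x y z ∧ IsPositivelyTangentAt o γ x y a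
  map_tangency : ∀ (a : γ) (x y z : Plane), IsBilliardTrajectory Γ x y z →
    IsPositivelyTangentAt o γ x y a → IsPositivelyTangentAt o γ y z (T a)

open Real

/-! Parametrize the inner ellipse by `(a cos s, b sin s)`. Its tangent lines at `σ - δ` and `σ + δ`
meet at `(a cos σ, b sin σ) / cos δ`, which lies on the outer ellipse with semi-axes `A`, `B`
exactly when `cos² δ = p cos² σ + q sin² σ`, where `p = a²/A²` and `q = b²/B²` (`MeetAt`). Under
this relation, confocality gives `sin δ cos δ ± (p - q) sin σ cos σ = κ * speed (σ ± δ)` with the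
constant `κ = √(A² - a²)/(AB)` (`eq_speed`, `eq_speed'`).

This identity is used twice. The left-hand sides are, up to sign, the normal components at the
meeting point of the velocities at the two tangency points, so the unit velocities are mirror
images: the reflected line is again tangent to the inner ellipse (`reflection_velocity`). Divided by
`sin δ cos δ`, they are also the derivatives of `σ ± δ` along the curve of solutions, so `∫ dθ /
speed` from `σ - δ` to `σ + δ` is constant (`exists_arc_const`). This integral involves the inner
ellipse alone; normalized to total length one it is the cyclic coordinate, and each billiard map
adds a constant to it. Shifts commute.

The number `b` may be negative: its sign selects the direction of traversal that keeps the ellipse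
on the left for the given orientation. -/

lemma mul_cos_sq_add_mul_sin_sq_pos {p q : ℝ} (hp : 0 < p) (hq : 0 < q) (s : ℝ) :
    0 < p * cos s ^ 2 + q * sin s ^ 2 := by
  have h := sin_sq_add_cos_sq s
  rcases (sq_nonneg (sin s)).eq_or_lt with h0 | h0
  · rw [← h0, zero_add] at h
    rw [← h0, h]
    linarith
  · have := mul_pos hq h0
    positivity

/-! ### Speed and invariant length of an ellipse. -/

/-- The speed of the parametrization `s ↦ (a cos s, b sin s)`. -/
noncomputable def ellipseSpeed (a b s : ℝ) : ℝ :=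
  √(a ^ 2 * sin s ^ 2 + b ^ 2 * cos s ^ 2)

lemma ellipseSpeed_radicand_pos {a b : ℝ} (ha : a ≠ 0) (hb : b ≠ 0) (s : ℝ) :
    0 < a ^ 2 * sin s ^ 2 + b ^ 2 * cos s ^ 2 := by
  rw [add_comm]
  exact mul_cos_sq_add_mul_sin_sq_pos (by positivity) (by positivity) s

lemma ellipseSpeed_pos {a b : ℝ} (ha : a ≠ 0) (hb : b ≠ 0) (s : ℝ) : 0 < ellipseSpeed a b s :=
  sqrt_pos.2 (ellipseSpeed_radicand_pos ha hb s)

lemma ellipseSpeed_sq (a b s : ℝ) :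
    ellipseSpeed a b s ^ 2 = a ^ 2 * sin s ^ 2 + b ^ 2 * cos s ^ 2 :=
  sq_sqrt (by positivity)

lemma ellipseSpeed_neg_right (a b s : ℝ) : ellipseSpeed a (-b) s = ellipseSpeed a b s := by
  simp [ellipseSpeed]

lemma ellipseSpeed_neg (a b s : ℝ) : ellipseSpeed a b (-s) = ellipseSpeed a b s := by
  simp [ellipseSpeed]

lemma ellipseSpeed_periodic (a b : ℝ) : Function.Periodic (ellipseSpeed a b) (2 * π) := fun s => by
  simp [ellipseSpeed]

lemma continuous_ellipseSpeed_inv {a b : ℝ} (ha : a ≠ 0) (hb : b ≠ 0) :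
    Continuous fun s => (ellipseSpeed a b s)⁻¹ := by
  refine Continuous.inv₀ ?_ fun s => (ellipseSpeed_pos ha hb s).ne'
  unfold ellipseSpeed
  fun_prop

/-- The invariant length on the ellipse `s ↦ (a cos s, b sin s)`, up to a factor the arc length
weighted by the power `2/3` of the curvature. -/
noncomputable def ellipseArc (a b t : ℝ) : ℝ :=
  ∫ θ in (0 : ℝ)..t, (ellipseSpeed a b θ)⁻¹

lemma hasDerivAt_ellipseArc {a b : ℝ} (ha : a ≠ 0) (hb : b ≠ 0) (t : ℝ) :
    HasDerivAt (ellipseArc a b) (ellipseSpeed a b t)⁻¹ t :=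
  (continuous_ellipseSpeed_inv ha hb).integral_hasStrictDerivAt 0 t |>.hasDerivAt

lemma ellipseArc_neg_right (a b t : ℝ) : ellipseArc a (-b) t = ellipseArc a b t := by
  simp [ellipseArc, ellipseSpeed_neg_right]

lemma ellipseArc_neg (a b t : ℝ) : ellipseArc a b (-t) = -ellipseArc a b t := by
  have h := intervalIntegral.integral_comp_neg (a := 0) (b := t)
    (fun θ => (ellipseSpeed a b θ)⁻¹)
  simp only [ellipseSpeed_neg, neg_zero] at h
  rw [ellipseArc, ellipseArc, h, intervalIntegral.integral_symm]

lemma strictMono_ellipseArc {a b : ℝ} (ha : a ≠ 0) (hb : b ≠ 0) : StrictMono (ellipseArc a b) :=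
  strictMono_of_hasDerivAt_pos (hasDerivAt_ellipseArc ha hb)
    fun t => inv_pos.2 (ellipseSpeed_pos ha hb t)

lemma continuous_ellipseArc {a b : ℝ} (ha : a ≠ 0) (hb : b ≠ 0) : Continuous (ellipseArc a b) :=
  continuous_iff_continuousAt.2 fun t => (hasDerivAt_ellipseArc ha hb t).continuousAt

lemma ellipseArc_zero (a b : ℝ) : ellipseArc a b 0 = 0 := by simp [ellipseArc]

lemma ellipseArc_add_period {a b : ℝ} (ha : a ≠ 0) (hb : b ≠ 0) (t : ℝ) :
    ellipseArc a b (t + 2 * π) = ellipseArc a b t + ellipseArc a b (2 * π) := by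
  have hc := continuous_ellipseSpeed_inv ha hb
  have hp : Function.Periodic (fun s => (ellipseSpeed a b s)⁻¹) (2 * π) := fun s => by
    simp only [ellipseSpeed_periodic a b s]
  have h := hp.intervalIntegral_add_eq t 0
  rw [zero_add] at h
  rw [ellipseArc, ellipseArc, ellipseArc, ← h, intervalIntegral.integral_add_adjacent_intervals
    (hc.intervalIntegrable _ _) (hc.intervalIntegrable _ _)]

lemma ellipseArc_period_pos {a b : ℝ} (ha : a ≠ 0) (hb : b ≠ 0) : 0 < ellipseArc a b (2 * π) := by
  have := strictMono_ellipseArc ha hb two_pi_pos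
  rwa [ellipseArc_zero] at this

/-! ### Pairs of tangent lines that meet on a confocal ellipse. -/

/-- The discriminant identity for the relation between the parameters `σ - δ` and `σ + δ` of
two tangent lines of an ellipse which meet on a second ellipse. -/
lemma tangent_pair_discriminant {p q σ δ : ℝ}
    (h : cos δ ^ 2 = p * cos σ ^ 2 + q * sin σ ^ 2) :
    (sin δ * cos δ - (p - q) * (sin σ * cos σ)) ^ 2 =
      q * (1 - p) * cos (σ - δ) ^ 2 + p * (1 - q) * sin (σ - δ) ^ 2 := by
  have h1 := sin_sq_add_cos_sq σ
  have h2 := sin_sq_add_cos_sq δ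
  have e1 : cos σ ^ 2 = 1 - sin σ ^ 2 := by linarith
  rw [e1] at h
  have e2 : sin δ ^ 2 = 1 - (p * (1 - sin σ ^ 2) + q * sin σ ^ 2) := by linarith
  have key : sin δ ^ 2 * cos δ ^ 2 + (p - q) ^ 2 * (sin σ ^ 2 * cos σ ^ 2) =
      q * (1 - p) * (cos σ ^ 2 * cos δ ^ 2 + sin σ ^ 2 * sin δ ^ 2) +
        p * (1 - q) * (sin σ ^ 2 * cos δ ^ 2 + cos σ ^ 2 * sin δ ^ 2) := by
    rw [e1, e2, h]
    ring
  rw [cos_sub, sin_sub]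
  linear_combination key

/-- The difference of the two squares is `p (1 - p) cos² σ + q (1 - q) sin² σ > 0`. This settles the
sign when square roots are taken in the discriminant identity. -/
lemma tangent_pair_sign {p q σ δ : ℝ} (hp : 0 < p) (hp1 : p < 1) (hq : 0 < q) (hq1 : q < 1)
    (hs : 0 < sin δ) (hc : 0 < cos δ)
    (h : cos δ ^ 2 = p * cos σ ^ 2 + q * sin σ ^ 2) :
    |(p - q) * (sin σ * cos σ)| < sin δ * cos δ := by
  refine abs_lt_of_sq_lt_sq ?_ (by positivity)
  have h1 := sin_sq_add_cos_sq σ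
  have h2 := sin_sq_add_cos_sq δ
  have key : (sin δ * cos δ) ^ 2 - ((p - q) * (sin σ * cos σ)) ^ 2 =
      p * (1 - p) * cos σ ^ 2 + q * (1 - q) * sin σ ^ 2 := by
    have e1 : sin δ ^ 2 = 1 - (p * cos σ ^ 2 + q * sin σ ^ 2) := by linarith
    have e2 : cos σ ^ 2 = 1 - sin σ ^ 2 := by linarith
    rw [mul_pow, mul_pow, mul_pow, e1, h, e2]
    ring
  have : 0 < p * (1 - p) * cos σ ^ 2 + q * (1 - q) * sin σ ^ 2 :=
    mul_cos_sq_add_mul_sin_sq_pos (mul_pos hp (by linarith)) (mul_pos hq (by linarith)) σ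
  linarith

/-- Two confocal ellipses with semi-axes `a`, `|b|` and `A`, `B`, the first inside the second. -/
structure NestedAxes (a b A B : ℝ) : Prop where
  pos : 0 < a
  ne_zero : b ≠ 0
  lt : a < A
  pos' : 0 < B
  confocal : A ^ 2 - a ^ 2 = B ^ 2 - b ^ 2

namespace NestedAxes

variable {a b A B : ℝ} (N : NestedAxes a b A B)
include N

lemma pos_outer : 0 < A := N.pos.trans N.lt

lemma sq_lt : a ^ 2 < A ^ 2 := pow_lt_pow_left₀ N.lt N.pos.le two_ne_zero

lemma ratio_pos : 0 < a ^ 2 / A ^ 2 := by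
  have := N.pos
  have := N.pos_outer
  positivity

lemma ratio_lt_one : a ^ 2 / A ^ 2 < 1 := by
  have := N.pos_outer
  rw [div_lt_one (by positivity)]
  exact N.sq_lt

lemma ratio_pos' : 0 < b ^ 2 / B ^ 2 := by
  have := N.ne_zero
  have := N.pos'
  positivity

lemma ratio_lt_one' : b ^ 2 / B ^ 2 < 1 := by
  have := N.pos'
  rw [div_lt_one (by positivity)]
  linarith [N.sq_lt, N.confocal]

/-- The two tangent lines of the inner ellipse at the parameters `σ ± δ` meet at a point of the
outer ellipse. -/
def MeetAt (a b A B σ δ : ℝ) : Prop :=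
  cos δ ^ 2 = a ^ 2 / A ^ 2 * cos σ ^ 2 + b ^ 2 / B ^ 2 * sin σ ^ 2

omit N in
lemma meetAt_neg {σ δ : ℝ} (h : MeetAt a b A B σ δ) : MeetAt a b A B σ (-δ) := by
  simpa [MeetAt] using h

/-- Confocality enters here: since `A² - a² = B² - b²`, the coefficients `q (1 - p)` and `p (1 - q)`
of the discriminant identity are `b²` and `a²` times the same factor `(A² - a²)/(AB)²`. -/
lemma sq_eq_speed_sq {σ δ : ℝ} (h : MeetAt a b A B σ δ) :
    (sin δ * cos δ - (a ^ 2 / A ^ 2 - b ^ 2 / B ^ 2) * (sin σ * cos σ)) ^ 2 =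
      (√(A ^ 2 - a ^ 2) / (A * B) * ellipseSpeed a b (σ - δ)) ^ 2 := by
  have hA := N.pos_outer.ne'
  have hB := N.pos'.ne'
  rw [tangent_pair_discriminant h, mul_pow, ellipseSpeed_sq, div_pow,
    sq_sqrt (by linarith [N.sq_lt])]
  have e : B ^ 2 = A ^ 2 - a ^ 2 + b ^ 2 := by linarith [N.confocal]
  field_simp
  rw [e]
  ring

lemma eq_speed {σ δ : ℝ} (hs : 0 < sin δ) (hc : 0 < cos δ) (h : MeetAt a b A B σ δ) :
    sin δ * cos δ - (a ^ 2 / A ^ 2 - b ^ 2 / B ^ 2) * (sin σ * cos σ) =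
      √(A ^ 2 - a ^ 2) / (A * B) * ellipseSpeed a b (σ - δ) := by
  have h1 := abs_lt.1
    (tangent_pair_sign N.ratio_pos N.ratio_lt_one N.ratio_pos' N.ratio_lt_one' hs hc h)
  have := N.pos_outer
  have := N.pos'
  have h2 := (ellipseSpeed_pos N.pos.ne' N.ne_zero (σ - δ)).le
  exact (pow_left_inj₀ (by linarith [h1.2]) (by positivity) two_ne_zero).1 (N.sq_eq_speed_sq h)

/-- The relation `MeetAt` is even in `δ`, so the squared identity at `-δ` yields the other tangency
point. -/
lemma eq_speed' {σ δ : ℝ} (hs : 0 < sin δ) (hc : 0 < cos δ) (h : MeetAt a b A B σ δ) :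
    sin δ * cos δ + (a ^ 2 / A ^ 2 - b ^ 2 / B ^ 2) * (sin σ * cos σ) =
      √(A ^ 2 - a ^ 2) / (A * B) * ellipseSpeed a b (σ + δ) := by
  have h1 := abs_lt.1
    (tangent_pair_sign N.ratio_pos N.ratio_lt_one N.ratio_pos' N.ratio_lt_one' hs hc h)
  have := N.pos_outer
  have := N.pos'
  have h2 := (ellipseSpeed_pos N.pos.ne' N.ne_zero (σ + δ)).le
  have h3 := N.sq_eq_speed_sq (meetAt_neg h)
  rw [sub_neg_eq_add, cos_neg, sin_neg] at h3
  refine (pow_left_inj₀ (by linarith [h1.1]) (by positivity) two_ne_zero).1 ?_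
  rw [← h3]
  ring

/-- The invariant length between the tangency points of the two tangent lines from a point of
the outer ellipse does not depend on the point. -/
theorem exists_arc_const : ∃ c : ℝ, ∀ s δ : ℝ, 0 < δ → δ < π / 2 → MeetAt a b A B (s + δ) δ →
    ellipseArc a b (s + 2 * δ) = ellipseArc a b s + c := by
  have hp0 := N.ratio_pos
  have hp1 := N.ratio_lt_one
  have hq0 := N.ratio_pos'
  have hq1 := N.ratio_lt_one'
  have hspeed := ellipseSpeed_pos N.pos.ne' N.ne_zero
  have heq := @eq_speed _ _ _ _ N
  have heq' := @eq_speed' _ _ _ _ N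
  unfold MeetAt at *
  set p := a ^ 2 / A ^ 2
  set q := b ^ 2 / B ^ 2
  -- `g σ` is the value of `cos (2 δ)` prescribed by `MeetAt`, so `D` below solves the relation for
  -- `δ` in `(0, π/2)`.
  set g : ℝ → ℝ := fun σ => p + q - 1 + (p - q) * cos (2 * σ) with hg
  have hgσ : ∀ σ, g σ = 2 * (p * cos σ ^ 2 + q * sin σ ^ 2) - 1 := fun σ => by
    simp only [hg]
    rw [cos_two_mul, sin_sq]
    ring
  have hval : ∀ σ, 0 < p * cos σ ^ 2 + q * sin σ ^ 2 ∧ p * cos σ ^ 2 + q * sin σ ^ 2 < 1 := by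
    intro σ
    have h1 := sin_sq_add_cos_sq σ
    have h2 := mul_cos_sq_add_mul_sin_sq_pos (sub_pos.2 hp1) (sub_pos.2 hq1) σ
    exact ⟨mul_cos_sq_add_mul_sin_sq_pos hp0 hq0 σ, by linarith⟩
  have hg1 : ∀ σ, -1 < g σ := fun σ => by linarith [hgσ σ, (hval σ).1]
  have hg2 : ∀ σ, g σ < 1 := fun σ => by linarith [hgσ σ, (hval σ).2]
  set D : ℝ → ℝ := fun σ => arccos (g σ) / 2 with hD
  have hD0 : ∀ σ, 0 < D σ := fun σ => half_pos (arccos_pos.2 (hg2 σ))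
  have hD1 : ∀ σ, D σ < π / 2 := fun σ => by
    have h : arccos (g σ) ≠ π := fun h => by
      have := arccos_eq_pi.1 h
      linarith [hg1 σ]
    exact div_lt_div_of_pos_right (lt_of_le_of_ne (arccos_le_pi _) h) two_pos
  have hDcos : ∀ σ, cos (2 * D σ) = g σ := fun σ => by
    rw [hD, mul_div_cancel₀ _ two_ne_zero, cos_arccos (hg1 σ).le (hg2 σ).le]
  have hmeet : ∀ σ, cos (D σ) ^ 2 = p * cos σ ^ 2 + q * sin σ ^ 2 := fun σ => by
    have := hDcos σ
    rw [cos_two_mul, hgσ] at this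
    linarith
  have hsD : ∀ σ, 0 < sin (D σ) := fun σ => sin_pos_of_pos_of_lt_pi (hD0 σ) (by
    linarith [hD1 σ, pi_pos])
  have hcD : ∀ σ, 0 < cos (D σ) := fun σ => cos_pos_of_mem_Ioo
    ⟨by linarith [hD0 σ, pi_pos], hD1 σ⟩
  have hderiv : ∀ σ, HasDerivAt D
      ((p - q) * (sin σ * cos σ) / (sin (D σ) * cos (D σ))) σ := fun σ => by
    have h1 : HasDerivAt g ((p - q) * (-sin (2 * σ) * 2)) σ := by
      have := (((hasDerivAt_id σ).const_mul 2).cos.const_mul (p - q)).const_add (p + q - 1)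
      exact this.congr_deriv (by simp)
    have h2 := (hasDerivAt_arccos (hg1 σ).ne' (hg2 σ).ne).comp σ h1
    have h3 := h2.div_const 2
    refine h3.congr_deriv ?_
    have h4 : √(1 - g σ ^ 2) = 2 * sin (D σ) * cos (D σ) := by
      rw [← sin_two_mul, ← hDcos, ← abs_sin_eq_sqrt_one_sub_cos_sq, abs_of_pos]
      rw [sin_two_mul]
      have := hsD σ
      have := hcD σ
      positivity
    have := (hsD σ).ne'
    have := (hcD σ).ne'
    rw [h4, sin_two_mul]
    field_simp
  -- The derivative of `σ ± D σ` is a common factor times the speed at `σ ± D σ`, and the integrand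
  -- is the inverse speed: the two endpoint contributions cancel.
  have hconst : ∀ σ, HasDerivAt
      (fun σ => ellipseArc a b (σ + D σ) - ellipseArc a b (σ - D σ)) 0 σ := fun σ => by
    have h1 := (hasDerivAt_ellipseArc N.pos.ne' N.ne_zero (σ + D σ)).comp σ
      ((hasDerivAt_id σ).add (hderiv σ))
    have h2 := (hasDerivAt_ellipseArc N.pos.ne' N.ne_zero (σ - D σ)).comp σ
      ((hasDerivAt_id σ).sub (hderiv σ))
    refine (h1.sub h2).congr_deriv ?_
    have e1 := heq (hsD σ) (hcD σ) (hmeet σ)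
    have e2 := heq' (hsD σ) (hcD σ) (hmeet σ)
    have n1 := (hspeed (σ - D σ)).ne'
    have n2 := (hspeed (σ + D σ)).ne'
    have n3 := (hsD σ).ne'
    have n4 := (hcD σ).ne'
    field_simp
    linear_combination ellipseSpeed a b (σ - D σ) * e2 - ellipseSpeed a b (σ + D σ) * e1
  refine ⟨ellipseArc a b (0 + D 0) - ellipseArc a b (0 - D 0), fun s δ hδ0 hδ1 h => ?_⟩
  have h1 : D (s + δ) = δ := by
    have h2 : g (s + δ) = cos (2 * δ) := by rw [hgσ, ← h, cos_two_mul]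
    simp only [hD]
    rw [h2, arccos_cos (by linarith) (by linarith)]
    ring
  have h3 := is_const_of_deriv_eq_zero (fun σ => (hconst σ).differentiableAt)
    (fun σ => (hconst σ).deriv) (s + δ) 0
  simp only [h1] at h3
  rw [← h3, show s + δ + δ = s + 2 * δ by ring, show s + δ - δ = s by ring]
  ring

end NestedAxes

/-! ### Coordinates in an orthonormal frame. -/

/-- The vector with coordinates `u`, `v` in the orthonormal basis `e`. -/
noncomputable def frameVec (e : OrthonormalBasis (Fin 2) ℝ Plane) (u v : ℝ) : Plane :=
  u • e 0 + v • e 1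

section Frame

variable (e : OrthonormalBasis (Fin 2) ℝ Plane)

lemma frameVec_add (u v u' v' : ℝ) :
    frameVec e u v + frameVec e u' v' = frameVec e (u + u') (v + v') := by
  simp only [frameVec]
  module

lemma frameVec_sub (u v u' v' : ℝ) :
    frameVec e u v - frameVec e u' v' = frameVec e (u - u') (v - v') := by
  simp only [frameVec]
  module

lemma smul_frameVec (r u v : ℝ) : r • frameVec e u v = frameVec e (r * u) (r * v) := by
  simp only [frameVec]
  module

lemma inner_frameVec (u v u' v' : ℝ) :
    inner ℝ (frameVec e u v) (frameVec e u' v') = u * u' + v * v' := by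
  have h00 := e.inner_eq_one 0
  have h11 := e.inner_eq_one 1
  have h01 : inner ℝ (e 0) (e 1) = (0 : ℝ) := e.inner_eq_zero (by decide)
  have h10 : inner ℝ (e 1) (e 0) = (0 : ℝ) := e.inner_eq_zero (by decide)
  simp only [frameVec, inner_add_left, inner_add_right, real_inner_smul_left,
    real_inner_smul_right, h00, h11, h01, h10]
  ring

lemma norm_frameVec_sq (u v : ℝ) : ‖frameVec e u v‖ ^ 2 = u ^ 2 + v ^ 2 := by
  rw [← real_inner_self_eq_norm_sq, inner_frameVec]
  ring

lemma exists_eq_frameVec (w : Plane) : ∃ u v, w = frameVec e u v := by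
  refine ⟨e.repr w 0, e.repr w 1, ?_⟩
  rw [frameVec]
  conv_lhs => rw [← e.sum_repr w]
  rw [Fin.sum_univ_two]

lemma inner_basis_zero_frameVec (u v : ℝ) : inner ℝ (e 0) (frameVec e u v) = u := by
  simpa [frameVec] using inner_frameVec e 1 0 u v

lemma inner_basis_one_frameVec (u v : ℝ) : inner ℝ (e 1) (frameVec e u v) = v := by
  simpa [frameVec] using inner_frameVec e 0 1 u v

lemma frameVec_inj {u v u' v' : ℝ} (h : frameVec e u v = frameVec e u' v') : u = u' ∧ v = v' := by
  constructor
  · rw [← inner_basis_zero_frameVec e u v, h, inner_basis_zero_frameVec]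
  · rw [← inner_basis_one_frameVec e u v, h, inner_basis_one_frameVec]

variable (o : Orientation ℝ Plane (Fin 2))

lemma areaForm_frameVec (u v u' v' : ℝ) :
    o.areaForm (frameVec e u v) (frameVec e u' v') =
      (u * v' - v * u') * o.areaForm (e 0) (e 1) := by
  simp only [frameVec, map_add, map_smul, LinearMap.add_apply, LinearMap.smul_apply,
    o.areaForm_apply_self, o.areaForm_swap (e 1) (e 0), smul_eq_mul]
  ring

lemma areaForm_basis_ne_zero : o.areaForm (e 0) (e 1) ≠ 0 := by
  have h := o.abs_areaForm_of_orthogonal (e.inner_eq_zero (show (0 : Fin 2) ≠ 1 by decide))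
  rw [e.norm_eq_one, e.norm_eq_one] at h
  intro h0
  simp [h0] at h

/-- The reflection in the line with normal vector `(n₁, n₂)` takes a unit vector to each other unit
vector, not its opposite, which makes the opposite angle with the line. -/
lemma reflection_frameVec {K : Submodule ℝ Plane} {n₁ n₂ u₁ u₂ v₁ v₂ : ℝ}
    (hK : ∀ w₁ w₂, frameVec e w₁ w₂ ∈ K ↔ w₁ * n₁ + w₂ * n₂ = 0)
    (hn : n₁ ≠ 0 ∨ n₂ ≠ 0) (hu : u₁ ^ 2 + u₂ ^ 2 = 1) (hv : v₁ ^ 2 + v₂ ^ 2 = 1)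
    (hcross : u₁ * v₂ - u₂ * v₁ ≠ 0) (hsum : (u₁ + v₁) * n₁ + (u₂ + v₂) * n₂ = 0) :
    K.reflection (frameVec e u₁ u₂) = frameVec e v₁ v₂ := by
  have h1 : frameVec e (u₁ + v₁) (u₂ + v₂) ∈ K := (hK _ _).2 hsum
  have h2 : frameVec e (u₁ - v₁) (u₂ - v₂) ∈ Kᗮ := by
    rw [Submodule.mem_orthogonal]
    intro w hw
    obtain ⟨w₁, w₂, rfl⟩ := exists_eq_frameVec e w
    rw [hK] at hw
    rw [inner_frameVec]
    -- Both `w` and `u + v` are perpendicular to the normal, hence parallel; `u + v` is nonzero by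
    -- `hcross` and orthogonal to `u - v` because `u` and `v` are unit vectors.
    have hpar : w₁ * (u₂ + v₂) - w₂ * (u₁ + v₁) = 0 := by
      rcases hn with h | h
      · refine (mul_eq_zero.1 ?_).resolve_right h
        linear_combination (u₂ + v₂) * hw - w₂ * hsum
      · refine (mul_eq_zero.1 ?_).resolve_right h
        linear_combination w₁ * hsum - (u₁ + v₁) * hw
    have hne : u₁ + v₁ ≠ 0 ∨ u₂ + v₂ ≠ 0 := by
      by_contra! h
      apply hcross
      linear_combination u₁ * h.2 - u₂ * h.1
    rcases hne with h | h
    · refine (mul_eq_zero.1 ?_).resolve_right h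
      linear_combination w₁ * hu - w₁ * hv - (u₂ - v₂) * hpar
    · refine (mul_eq_zero.1 ?_).resolve_right h
      linear_combination w₂ * hu - w₂ * hv + (u₁ - v₁) * hpar
  have e1 : frameVec e u₁ u₂ = (1 / 2 : ℝ) • frameVec e (u₁ + v₁) (u₂ + v₂) +
      (1 / 2 : ℝ) • frameVec e (u₁ - v₁) (u₂ - v₂) := by
    rw [smul_frameVec, smul_frameVec, frameVec_add]
    congr 1 <;> ring
  rw [e1, map_add, map_smul, map_smul, Submodule.reflection_mem_subspace_eq_self h1,
    Submodule.reflection_mem_subspace_orthogonalComplement_eq_neg h2, smul_neg, ← sub_eq_add_neg,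
    smul_frameVec, smul_frameVec, frameVec_sub]
  congr 1 <;> ring

end Frame

/-! ### Equation, parametrization and tangents of an ellipse. -/

lemma exists_eq_cos_sin {x y : ℝ} (h : x ^ 2 + y ^ 2 = 1) : ∃ s, x = cos s ∧ y = sin s := by
  have h1 : ‖(⟨x, y⟩ : ℂ)‖ = 1 := by
    rw [← sq_eq_sq₀ (norm_nonneg _) zero_le_one, Complex.sq_norm, Complex.normSq_mk]
    linarith
  refine ⟨Complex.arg ⟨x, y⟩, ?_, ?_⟩
  · rw [Complex.cos_arg (by intro h; simp [h] at h1), h1, div_one]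
  · rw [Complex.sin_arg, h1, div_one]

/-- `a` and `|b|` are the semi-axes of an ellipse with focal distance `2 c`. -/
structure EllipseAxes (c a b : ℝ) : Prop where
  nonneg : 0 ≤ c
  lt : c < a
  sq_eq : b ^ 2 = a ^ 2 - c ^ 2

/-- The ellipse with centre `C`, axes parallel to the vectors of `e`, focal distance `2 c` and
major axis `2 a`. -/
abbrev framedEllipse (C : Plane) (e : OrthonormalBasis (Fin 2) ℝ Plane) (c a : ℝ) : Set Plane :=
  ellipse (C + frameVec e (-c) 0) (C + frameVec e c 0) (2 * a)

/-- The point with parameter `s` of an ellipse. -/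
noncomputable def ellipsePoint (C : Plane) (e : OrthonormalBasis (Fin 2) ℝ Plane) (a b s : ℝ) :
    Plane :=
  C + frameVec e (a * cos s) (b * sin s)

/-- The velocity of the parametrization `ellipsePoint`. -/
noncomputable def ellipseVelocity (e : OrthonormalBasis (Fin 2) ℝ Plane) (a b s : ℝ) : Plane :=
  frameVec e (-a * sin s) (b * cos s)

lemma norm_ellipseVelocity (e : OrthonormalBasis (Fin 2) ℝ Plane) (a b s : ℝ) :
    ‖ellipseVelocity e a b s‖ = ellipseSpeed a b s := by
  refine (pow_left_inj₀ (norm_nonneg _) (sqrt_nonneg _) two_ne_zero).1 ?_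
  change _ = ellipseSpeed a b s ^ 2
  rw [ellipseVelocity, norm_frameVec_sq, ellipseSpeed_sq]
  ring

namespace EllipseAxes

variable {c a b : ℝ} (E : EllipseAxes c a b)
include E

lemma pos : 0 < a := E.nonneg.trans_lt E.lt

lemma ne_zero : b ≠ 0 := by
  intro h
  have h1 := E.sq_eq
  have h2 := pow_lt_pow_left₀ E.lt E.nonneg two_ne_zero
  rw [h] at h1
  linarith

lemma neg : EllipseAxes c a (-b) := ⟨E.nonneg, E.lt, by rw [neg_sq, E.sq_eq]⟩

variable (C : Plane) (e : OrthonormalBasis (Fin 2) ℝ Plane)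

/-- On the ellipse the focal distances are `a ± u c / a`. For the converse, `|u c| ≤ a²` makes these
expressions nonnegative, so they may be recovered from their squares. -/
lemma mem_ellipse_iff {u v : ℝ} :
    C + frameVec e u v ∈ framedEllipse C e c a ↔ u ^ 2 / a ^ 2 + v ^ 2 / b ^ 2 = 1 := by
  have ha := E.pos
  have hb := E.ne_zero
  have hb2 := E.sq_eq
  have h1 : dist (C + frameVec e u v) (C + frameVec e (-c) 0) ^ 2 = (u + c) ^ 2 + v ^ 2 := by
    rw [dist_add_left, dist_eq_norm, frameVec_sub, norm_frameVec_sq]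
    ring
  have h2 : dist (C + frameVec e u v) (C + frameVec e c 0) ^ 2 = (u - c) ^ 2 + v ^ 2 := by
    rw [dist_add_left, dist_eq_norm, frameVec_sub, norm_frameVec_sq]
    ring
  have hd1 := dist_nonneg (x := C + frameVec e u v) (y := C + frameVec e (-c) 0)
  have hd2 := dist_nonneg (x := C + frameVec e u v) (y := C + frameVec e c 0)
  change dist (C + frameVec e u v) (C + frameVec e (-c) 0) +
    dist (C + frameVec e u v) (C + frameVec e c 0) = 2 * a ↔ _
  set d1 := dist (C + frameVec e u v) (C + frameVec e (-c) 0)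
  set d2 := dist (C + frameVec e u v) (C + frameVec e c 0)
  rw [div_add_div _ _ (by positivity) (by positivity), div_eq_one_iff_eq (by positivity)]
  constructor
  · intro h
    have h3 : a * d1 = a ^ 2 + u * c := by
      have : d2 = 2 * a - d1 := by linarith
      rw [this] at h2
      linarith
    rw [hb2]
    have h4 : (a * d1) ^ 2 = a ^ 2 * ((u + c) ^ 2 + v ^ 2) := by rw [mul_pow, h1]
    rw [h3] at h4
    linarith
  · intro h
    have hu : u ^ 2 ≤ a ^ 2 := by
      have hb3 : 0 < b ^ 2 := by positivity
      have : 0 ≤ a ^ 2 * v ^ 2 := by positivity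
      exact le_of_mul_le_mul_right (by linarith) hb3
    have huc : |u * c| ≤ a * a := by
      rw [abs_mul, abs_of_nonneg E.nonneg]
      exact mul_le_mul (abs_le_of_sq_le_sq hu ha.le) E.lt.le E.nonneg ha.le
    have := abs_le.1 huc
    rw [hb2] at h
    have e1 : a * d1 = a ^ 2 + u * c := by
      rw [← pow_left_inj₀ (by positivity) (by linarith) two_ne_zero, mul_pow, h1]
      linarith
    have e2 : a * d2 = a ^ 2 - u * c := by
      rw [← pow_left_inj₀ (by positivity) (by linarith) two_ne_zero, mul_pow, h2]
      linarith
    refine mul_left_cancel₀ ha.ne' ?_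
    linarith

lemma ellipsePoint_mem (s : ℝ) : ellipsePoint C e a b s ∈ framedEllipse C e c a := by
  rw [ellipsePoint, E.mem_ellipse_iff]
  have := E.pos.ne'
  have := E.ne_zero
  field_simp
  exact cos_sq_add_sin_sq s

lemma exists_eq_ellipsePoint {P : Plane} (hP : P ∈ framedEllipse C e c a) :
    ∃ s, P = ellipsePoint C e a b s := by
  obtain ⟨u, v, h⟩ := exists_eq_frameVec e (P - C)
  obtain rfl : P = C + frameVec e u v := by rw [← h]; abel
  rw [E.mem_ellipse_iff, ← div_pow, ← div_pow] at hP
  obtain ⟨s, h1, h2⟩ := exists_eq_cos_sin hP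
  refine ⟨s, ?_⟩
  rw [ellipsePoint, ← h1, ← h2, mul_div_cancel₀ _ E.pos.ne', mul_div_cancel₀ _ E.ne_zero]

omit E in
lemma hasDerivAt_ellipsePoint (s : ℝ) :
    HasDerivAt (ellipsePoint C e a b) (ellipseVelocity e a b s) s := by
  have h := ((((hasDerivAt_cos s).const_mul a).smul_const (e 0)).add
    (((hasDerivAt_sin s).const_mul b).smul_const (e 1))).const_add C
  refine h.congr_deriv ?_
  rw [ellipseVelocity, frameVec]
  module

lemma frameVec_eq_smul_velocity {w₁ w₂ s : ℝ} (h : w₁ * cos s / a + w₂ * sin s / b = 0) :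
    ∃ μ : ℝ, frameVec e w₁ w₂ = μ • ellipseVelocity e a b s := by
  have ha := E.pos.ne'
  have hb := E.ne_zero
  have hs := sin_sq_add_cos_sq s
  refine ⟨-w₁ * sin s / a + w₂ * cos s / b, ?_⟩
  rw [ellipseVelocity, smul_frameVec]
  field_simp at h
  congr 1
  · field_simp
    linear_combination cos s * h - w₁ * b * hs
  · field_simp
    linear_combination sin s * h - w₂ * a * hs

/-- The defining quadratic function maps the ellipse to the single value `1`, so its derivative
kills the tangent cone. Conversely, the velocity of the parametrization lies in the cone and spans
the kernel. -/
lemma mem_tangentDirection_iff {u v : ℝ} (h : u ^ 2 / a ^ 2 + v ^ 2 / b ^ 2 = 1) (w₁ w₂ : ℝ) :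
    frameVec e w₁ w₂ ∈ tangentDirection (framedEllipse C e c a) (C + frameVec e u v) ↔
      w₁ * (u / a ^ 2) + w₂ * (v / b ^ 2) = 0 := by
  have ha := E.pos.ne'
  have hb := E.ne_zero
  constructor
  · let f : Plane → ℝ := fun P =>
      inner ℝ (e 0) (P - C) ^ 2 / a ^ 2 + inner ℝ (e 1) (P - C) ^ 2 / b ^ 2
    let f' : Plane →L[ℝ] ℝ :=
      (2 * u / a ^ 2) • innerSL ℝ (e 0) + (2 * v / b ^ 2) • innerSL ℝ (e 1)
    have hf : HasFDerivAt f f' (C + frameVec e u v) := by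
      have h0 : ∀ i, HasFDerivAt (fun P : Plane => inner ℝ (e i) (P - C)) (innerSL ℝ (e i))
          (C + frameVec e u v) := fun i =>
        (innerSL ℝ (e i)).hasFDerivAt.comp
          (C + frameVec e u v) ((hasFDerivAt_id (C + frameVec e u v)).sub_const C)
      have h1 := (((h0 0).pow 2).mul_const (a ^ 2)⁻¹).add (((h0 1).pow 2).mul_const (b ^ 2)⁻¹)
      refine h1.congr_fderiv ?_
      ext w
      simp [f', inner_basis_zero_frameVec, inner_basis_one_frameVec]
      ring
    have himg : f '' framedEllipse C e c a ⊆ {1} := by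
      rintro _ ⟨P, hP, rfl⟩
      obtain ⟨u', v', h'⟩ := exists_eq_frameVec e (P - C)
      obtain rfl : P = C + frameVec e u' v' := by rw [← h']; abel
      rw [E.mem_ellipse_iff] at hP
      simpa [f, inner_basis_zero_frameVec, inner_basis_one_frameVec] using hP
    have hcone : tangentConeAt ℝ (framedEllipse C e c a) (C + frameVec e u v) ⊆
        LinearMap.ker f'.toLinearMap := by
      intro w hw
      have h1 := hf.hasFDerivWithinAt.mapsTo_tangent_cone hw
      have h2 := tangentConeAt_mono himg h1
      have h3 : ¬ AccPt (f (C + frameVec e u v)) (Filter.principal {1}) := by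
        exact fun h => Set.Infinite.of_accPt h (Set.finite_singleton (1 : ℝ))
      exact tangentConeAt_subset_zero h3 h2
    intro hw
    have := Submodule.span_le.2 hcone hw
    have h4 : f' (frameVec e w₁ w₂) = 0 := this
    simp only [f', add_apply, smul_apply, innerSL_apply_apply,
      inner_basis_zero_frameVec, inner_basis_one_frameVec, smul_eq_mul] at h4
    linear_combination h4 / 2
  · intro hw
    have h' := h
    rw [← div_pow, ← div_pow] at h'
    obtain ⟨s, h1, h2⟩ := exists_eq_cos_sin h'
    have e1 : u = a * cos s := by rw [← h1, mul_div_cancel₀ _ ha]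
    have e2 : v = b * sin s := by rw [← h2, mul_div_cancel₀ _ hb]
    have hcone : ellipseVelocity e a b s ∈
        tangentConeAt ℝ (framedEllipse C e c a) (C + frameVec e u v) := by
      have h3 := (hasDerivAt_ellipsePoint (a := a) (b := b) C e s).hasFDerivAt.hasFDerivWithinAt
        (s := Set.univ) |>.mapsTo_tangent_cone
      rw [tangentConeAt_univ] at h3
      replace h3 := h3 (Set.mem_univ (1 : ℝ))
      rw [e1, e2]
      refine tangentConeAt_mono ?_ (by simpa [ellipsePoint] using h3)
      rintro _ ⟨t, -, rfl⟩
      exact E.ellipsePoint_mem C e t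
    obtain ⟨μ, hμ⟩ := E.frameVec_eq_smul_velocity e (w₁ := w₁) (w₂ := w₂) (s := s) (by
      rw [e1, e2] at hw
      rw [← hw]
      field_simp)
    rw [hμ]
    exact Submodule.smul_mem _ μ (Submodule.subset_span (R := ℝ) hcone)

lemma exists_eq_smul_velocity {s : ℝ} {w : Plane}
    (hw : w ∈ tangentDirection (framedEllipse C e c a) (ellipsePoint C e a b s)) :
    ∃ μ : ℝ, w = μ • ellipseVelocity e a b s := by
  have ha := E.pos.ne'
  have hb := E.ne_zero
  obtain ⟨w₁, w₂, rfl⟩ := exists_eq_frameVec e w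
  rw [ellipsePoint, E.mem_tangentDirection_iff C e
    ((E.mem_ellipse_iff C e).1 (E.ellipsePoint_mem C e s))] at hw
  refine E.frameVec_eq_smul_velocity e ?_
  rw [← hw]
  field_simp

lemma velocity_mem_tangentDirection (s : ℝ) :
    ellipseVelocity e a b s ∈
      tangentDirection (framedEllipse C e c a) (ellipsePoint C e a b s) := by
  have ha := E.pos.ne'
  have hb := E.ne_zero
  rw [ellipsePoint, ellipseVelocity, E.mem_tangentDirection_iff C e
    ((E.mem_ellipse_iff C e).1 (E.ellipsePoint_mem C e s))]
  field_simp
  ring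

end EllipseAxes

/-! ### Intersection of a tangent line with the outer ellipse. -/

section Quadratic

variable {p q s : ℝ}

/-- The parameter values at which a tangent line of the unit circle meets an ellipse around the
circle are a negative and a positive one. -/
lemma neg_and_pos_of_tangent_line (hp : 0 < p) (hp1 : p < 1) (hq : 0 < q) (hq1 : q < 1)
    {r r' : ℝ} (hlt : r < r') (h : p * (cos s - r * sin s) ^ 2 + q * (sin s + r * cos s) ^ 2 = 1)
    (h' : p * (cos s - r' * sin s) ^ 2 + q * (sin s + r' * cos s) ^ 2 = 1) :
    r < 0 ∧ 0 < r' := by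
  have h1 := mul_cos_sq_add_mul_sin_sq_pos hq hp s
  have h2 := mul_cos_sq_add_mul_sin_sq_pos (sub_pos.2 hp1) (sub_pos.2 hq1) s
  have h3 := sin_sq_add_cos_sq s
  -- Vieta's formulas: `h4` is the sum of the roots and `h5` their product, which is negative.
  have h4 : (q * cos s ^ 2 + p * sin s ^ 2) * (r + r') = -2 * (q - p) * (sin s * cos s) := by
    refine mul_right_cancel₀ (sub_pos.2 hlt).ne' ?_
    linear_combination h' - h
  have h5 : (q * cos s ^ 2 + p * sin s ^ 2) * (r * r') =
      -((1 - p) * cos s ^ 2 + (1 - q) * sin s ^ 2) := by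
    linear_combination r' * h4 - h' + h3
  have h6 : r * r' < 0 := by
    by_contra! h7
    have := mul_nonneg h1.le h7
    linarith
  rcases mul_neg_iff.1 h6 with h7 | h7
  · linarith [h7.1, h7.2]
  · exact h7

lemma exists_tangent_line_meet (hp : 0 < p) (hp1 : p < 1) (hq : 0 < q) (hq1 : q < 1) (s : ℝ) :
    ∃ r r' : ℝ, r < r' ∧ p * (cos s - r * sin s) ^ 2 + q * (sin s + r * cos s) ^ 2 = 1 ∧
      p * (cos s - r' * sin s) ^ 2 + q * (sin s + r' * cos s) ^ 2 = 1 := by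
  have h1 := mul_cos_sq_add_mul_sin_sq_pos hq hp s
  have h2 := mul_cos_sq_add_mul_sin_sq_pos (sub_pos.2 hp1) (sub_pos.2 hq1) s
  have h3 := sin_sq_add_cos_sq s
  set α := q * cos s ^ 2 + p * sin s ^ 2 with hα
  set β := (q - p) * (sin s * cos s) with hβ
  set κ := (1 - p) * cos s ^ 2 + (1 - q) * sin s ^ 2 with hκ
  have hpos : 0 < β ^ 2 + α * κ := by positivity
  have hd := sq_sqrt hpos.le
  have hd0 := sqrt_pos.2 hpos
  have key : ∀ d, d ^ 2 = β ^ 2 + α * κ → p * (cos s - (-β + d) / α * sin s) ^ 2 +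
      q * (sin s + (-β + d) / α * cos s) ^ 2 = 1 := by
    intro d hd
    have e1 : p * (cos s - (-β + d) / α * sin s) ^ 2 + q * (sin s + (-β + d) / α * cos s) ^ 2 =
        1 + (α * ((-β + d) / α) ^ 2 + 2 * β * ((-β + d) / α) - κ) := by
      linear_combination (((-β + d) / α)) ^ 2 * -hα - 2 * ((-β + d) / α) * hβ + hκ + h3
    rw [e1]
    field_simp
    linear_combination hd
  exact ⟨(-β + -√(β ^ 2 + α * κ)) / α, (-β + √(β ^ 2 + α * κ)) / α,
    div_lt_div_of_pos_right (by linarith) h1, key _ (by rw [neg_sq, hd]), key _ hd⟩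

end Quadratic

/-! ### Oriented tangent lines. -/

section Tangency

variable (C : Plane) (e : OrthonormalBasis (Fin 2) ℝ Plane) (o : Orientation ℝ Plane (Fin 2))

lemma ellipsePoint_add_smul_velocity (a b s r : ℝ) :
    ellipsePoint C e a b s + r • ellipseVelocity e a b s =
      C + frameVec e (a * (cos s - r * sin s)) (b * (sin s + r * cos s)) := by
  rw [ellipsePoint, ellipseVelocity, smul_frameVec, add_assoc, frameVec_add]
  congr 2 <;> ring

/-- The factor `1 - cos (θ - s)` expresses strict convexity: the ellipse stays on one side of its
tangent line and touches it only once. -/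
lemma areaForm_velocity_sub (a b s θ : ℝ) :
    o.areaForm (ellipseVelocity e a b s) (ellipsePoint C e a b θ - ellipsePoint C e a b s) =
      a * (b * o.areaForm (e 0) (e 1)) * (1 - cos (θ - s)) := by
  rw [ellipsePoint, ellipsePoint, ellipseVelocity, add_sub_add_left_eq_sub, frameVec_sub,
    areaForm_frameVec, cos_sub]
  linear_combination a * b * o.areaForm (e 0) (e 1) * sin_sq_add_cos_sq s

lemma ellipsePoint_eq_of_cos_sub {a b s θ : ℝ} (h : cos (θ - s) = 1) :
    ellipsePoint C e a b θ = ellipsePoint C e a b s := by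
  obtain ⟨k, hk⟩ := (cos_eq_one_iff _).1 h
  obtain rfl : θ = s + k * (2 * π) := by linarith
  rw [ellipsePoint, ellipsePoint, cos_add_int_mul_two_pi, sin_add_int_mul_two_pi]

variable {C e o} {c a b : ℝ} (E : EllipseAxes c a b) (ho : 0 < b * o.areaForm (e 0) (e 1))
include E

omit ho in
lemma EllipseAxes.velocity_ne_zero (s : ℝ) : ellipseVelocity e a b s ≠ 0 := by
  rw [← norm_pos_iff, norm_ellipseVelocity]
  exact ellipseSpeed_pos E.pos.ne' E.ne_zero s

include ho

/-- The positively oriented tangent line at a point of the ellipse has the direction of the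
velocity. -/
lemma EllipseAxes.isPositivelyTangentAt_iff {x y : Plane} (hxy : x ≠ y) {s : ℝ} :
    IsPositivelyTangentAt o (framedEllipse C e c a) x y (ellipsePoint C e a b s) ↔
      ∃ r r' : ℝ, r < r' ∧ x = ellipsePoint C e a b s + r • ellipseVelocity e a b s ∧
        y = ellipsePoint C e a b s + r' • ellipseVelocity e a b s := by
  have hpos : 0 < a * (b * o.areaForm (e 0) (e 1)) := mul_pos E.pos ho
  constructor
  · rintro ⟨-, hline, htan, hleft⟩
    obtain ⟨k, hk⟩ := mem_affineSpan_pair_iff_exists_lineMap_eq.1 hline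
    obtain ⟨μ, hμ⟩ := E.exists_eq_smul_velocity C e htan
    rw [AffineMap.lineMap_apply, vsub_eq_sub, vadd_eq_add] at hk
    have hx : x = ellipsePoint C e a b s + (-(k * μ)) • ellipseVelocity e a b s := by
      rw [← hk, hμ]
      module
    have hy : y = ellipsePoint C e a b s + (μ - k * μ) • ellipseVelocity e a b s := by
      have : y = x + (y - x) := by abel
      rw [this, hμ]
      nth_rewrite 1 [hx]
      module
    refine ⟨_, _, ?_, hx, hy⟩
    -- The antipodal point lies strictly to the left of the velocity, so it detects the sign of `μ`.
    have h1 := hleft _ (E.ellipsePoint_mem C e (s + π))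
    have h2 : ellipsePoint C e a b (s + π) - x =
        (ellipsePoint C e a b (s + π) - ellipsePoint C e a b s) +
          (k * μ) • ellipseVelocity e a b s := by
      rw [hx]
      module
    rw [h2, hμ, map_smul, LinearMap.smul_apply, map_add, map_smul, o.areaForm_apply_self,
      areaForm_velocity_sub, add_sub_cancel_left, cos_pi] at h1
    simp only [smul_eq_mul, mul_zero, add_zero] at h1
    have h3 : 0 ≤ μ := by
      by_contra! h4
      have := mul_neg_of_neg_of_pos h4 (mul_pos hpos (show (0 : ℝ) < 1 - -1 by norm_num))
      linarith
    have h4 : μ ≠ 0 := by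
      rintro rfl
      rw [zero_smul, sub_eq_zero] at hμ
      exact hxy hμ.symm
    have := h3.lt_of_ne' h4
    linarith
  · rintro ⟨r, r', hlt, hx, hy⟩
    have hd : y - x = (r' - r) • ellipseVelocity e a b s := by
      rw [hx, hy]
      module
    refine ⟨E.ellipsePoint_mem C e s, ?_, ?_, ?_⟩
    · refine mem_affineSpan_pair_iff_exists_lineMap_eq.2 ⟨-r / (r' - r), ?_⟩
      rw [AffineMap.lineMap_apply, vsub_eq_sub, vadd_eq_add, hd, smul_smul,
        div_mul_cancel₀ _ (sub_pos.2 hlt).ne', hx]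
      module
    · rw [hd]
      exact Submodule.smul_mem _ _ (E.velocity_mem_tangentDirection C e s)
    · intro q hq
      obtain ⟨θ, rfl⟩ := E.exists_eq_ellipsePoint C e hq
      have h2 : ellipsePoint C e a b θ - x =
          (ellipsePoint C e a b θ - ellipsePoint C e a b s) +
            (-r) • ellipseVelocity e a b s := by
        rw [hx]
        module
      rw [h2, hd, map_smul, LinearMap.smul_apply, map_add, map_smul, o.areaForm_apply_self,
        areaForm_velocity_sub]
      simp only [smul_eq_mul, mul_zero, add_zero]
      exact mul_nonneg (sub_pos.2 hlt).le (mul_nonneg hpos.le (sub_nonneg.2 (cos_le_one _)))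

lemma EllipseAxes.eq_of_isPositivelyTangentAt {x y p q : Plane} (hxy : x ≠ y)
    (hp : IsPositivelyTangentAt o (framedEllipse C e c a) x y p)
    (hq : IsPositivelyTangentAt o (framedEllipse C e c a) x y q) : p = q := by
  obtain ⟨s, rfl⟩ := E.exists_eq_ellipsePoint C e hp.mem_curve
  obtain ⟨θ, rfl⟩ := E.exists_eq_ellipsePoint C e hq.mem_curve
  obtain ⟨r, r', hlt, hx, hy⟩ := (E.isPositivelyTangentAt_iff ho hxy).1 hp
  obtain ⟨k, hk⟩ := mem_affineSpan_pair_iff_exists_lineMap_eq.1 hq.mem_line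
  have hpos : 0 < a * (b * o.areaForm (e 0) (e 1)) := mul_pos E.pos ho
  rw [AffineMap.lineMap_apply, vsub_eq_sub, vadd_eq_add] at hk
  have h1 : ellipsePoint C e a b θ - ellipsePoint C e a b s =
      (k * (r' - r) + r) • ellipseVelocity e a b s := by
    rw [← hk, hx, hy]
    module
  have h2 := areaForm_velocity_sub C e o a b s θ
  rw [h1, map_smul, o.areaForm_apply_self, smul_zero] at h2
  have h3 := (mul_eq_zero.1 h2.symm).resolve_left hpos.ne'
  exact (ellipsePoint_eq_of_cos_sub C e (by linarith)).symm

end Tangency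

/-! ### Reflection of tangent lines and the shift of the invariant length. -/

namespace NestedAxes

variable {C : Plane} {e : OrthonormalBasis (Fin 2) ℝ Plane} {a b A B : ℝ} (N : NestedAxes a b A B)

/-- A point of the tangent line at parameter `s` which lies on the outer ellipse is the meeting
point with the tangent line at a parameter `s + 2 * δ`. -/
lemma meetAt_of_mem {s δ : ℝ} (hc : 0 < cos δ)
    (h : a ^ 2 / A ^ 2 * (cos s - tan δ * sin s) ^ 2 +
      b ^ 2 / B ^ 2 * (sin s + tan δ * cos s) ^ 2 = 1) : MeetAt a b A B (s + δ) δ := by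
  rw [tan_eq_sin_div_cos] at h
  have h1 : cos (s + δ) = cos δ * (cos s - sin δ / cos δ * sin s) := by
    rw [cos_add]
    field_simp
  have h2 : sin (s + δ) = cos δ * (sin s + sin δ / cos δ * cos s) := by
    rw [sin_add]
    field_simp
  rw [MeetAt, h1, h2]
  linear_combination -cos δ ^ 2 * h

/-- The two tangent lines meet at `ellipsePoint C e (a / cos δ) (b / cos δ) (s + δ)`. -/
lemma ellipsePoint_add_tan_smul (s : ℝ) {δ : ℝ} (hc : 0 < cos δ) :
    ellipsePoint C e a b s + tan δ • ellipseVelocity e a b s =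
      C + frameVec e (a * cos (s + δ) / cos δ) (b * sin (s + δ) / cos δ) := by
  rw [ellipsePoint_add_smul_velocity, tan_eq_sin_div_cos, cos_add, sin_add]
  congr 2 <;> field_simp

/-- The meeting point seen from the other tangent line: replace `s` by `s + 2 * δ` and `δ` by `-δ`.
-/
lemma ellipsePoint_sub_tan_smul (s : ℝ) {δ : ℝ} (hc : 0 < cos δ) :
    ellipsePoint C e a b (s + 2 * δ) + (-tan δ) • ellipseVelocity e a b (s + 2 * δ) =
      ellipsePoint C e a b s + tan δ • ellipseVelocity e a b s := by
  rw [ellipsePoint_add_tan_smul s hc, ← tan_neg, ellipsePoint_add_tan_smul _ (by rwa [cos_neg]),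
    cos_neg, show s + 2 * δ + -δ = s + δ by ring]

include N

/-- Against the normal `(u/A², v/B²)` of the outer ellipse at the meeting point, the two unit
velocities have components `√(A² - a²)/(AB)` and its negative, by `eq_speed` and `eq_speed'`. They
are not parallel, since `sin (2 * δ) ≠ 0`. -/
lemma reflection_velocity {c : ℝ} (E : EllipseAxes c A B) {s δ : ℝ}
    (hs : 0 < sin δ) (hc : 0 < cos δ) (h : MeetAt a b A B (s + δ) δ) :
    (tangentDirection (framedEllipse C e c A)
      (ellipsePoint C e a b s + tan δ • ellipseVelocity e a b s)).reflection
      ((ellipseSpeed a b s)⁻¹ • ellipseVelocity e a b s) =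
      (ellipseSpeed a b (s + 2 * δ))⁻¹ • ellipseVelocity e a b (s + 2 * δ) := by
  have hA := N.pos_outer.ne'
  have hB := N.pos'.ne'
  have ha := N.pos.ne'
  have hb := N.ne_zero
  have e1 := N.eq_speed hs hc h
  have e2 := N.eq_speed' hs hc h
  have p1 := (ellipseSpeed_pos ha hb s).ne'
  have p2 := (ellipseSpeed_pos ha hb (s + 2 * δ)).ne'
  have q1 := ellipseSpeed_sq a b s
  have q2 := ellipseSpeed_sq a b (s + 2 * δ)
  rw [MeetAt] at h
  rw [add_sub_cancel_right] at e1
  rw [show s + δ + δ = s + 2 * δ by ring] at e2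
  have f1 : sin s = sin (s + δ) * cos δ - cos (s + δ) * sin δ := by rw [← sin_sub]; ring_nf
  have f2 : cos s = cos (s + δ) * cos δ + sin (s + δ) * sin δ := by rw [← cos_sub]; ring_nf
  have f3 : sin (s + 2 * δ) = sin (s + δ) * cos δ + cos (s + δ) * sin δ := by
    rw [← sin_add]; ring_nf
  have f4 : cos (s + 2 * δ) = cos (s + δ) * cos δ - sin (s + δ) * sin δ := by
    rw [← cos_add]; ring_nf
  rw [ellipsePoint_add_tan_smul s hc, ellipseVelocity, ellipseVelocity, smul_frameVec,
    smul_frameVec]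
  refine reflection_frameVec e (E.mem_tangentDirection_iff C e ?_) ?_ ?_ ?_ ?_ ?_
  · field_simp at h ⊢
    linear_combination -h
  · by_contra! hn
    have h1 : cos (s + δ) = 0 := by simpa [ha, hA, hc.ne'] using hn.1
    have h2 : sin (s + δ) = 0 := by simpa [hb, hB, hc.ne'] using hn.2
    have := sin_sq_add_cos_sq (s + δ)
    simp [h1, h2] at this
  · field_simp
    linear_combination -q1
  · field_simp
    linear_combination -q2
  · have h1 : sin (2 * δ) ≠ 0 := by
      rw [sin_two_mul]
      positivity
    have h2 : sin (2 * δ) = sin (s + 2 * δ) * cos s - cos (s + 2 * δ) * sin s := by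
      rw [← sin_sub, add_sub_cancel_left]
    intro h3
    apply h1
    field_simp at h3
    rw [mul_zero] at h3
    rw [h2]
    linear_combination (mul_eq_zero.1 h3).resolve_left (mul_ne_zero ha hb)
  · have g1 : -a * sin s * (a * cos (s + δ) / cos δ / A ^ 2) +
        b * cos s * (b * sin (s + δ) / cos δ / B ^ 2) =
          √(A ^ 2 - a ^ 2) / (A * B) * ellipseSpeed a b s := by
      rw [← e1, f1, f2]
      field_simp
      field_simp at h
      linear_combination -sin δ * h
    have g2 : -a * sin (s + 2 * δ) * (a * cos (s + δ) / cos δ / A ^ 2) +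
        b * cos (s + 2 * δ) * (b * sin (s + δ) / cos δ / B ^ 2) =
          -(√(A ^ 2 - a ^ 2) / (A * B) * ellipseSpeed a b (s + 2 * δ)) := by
      rw [← e2, f3, f4]
      field_simp
      field_simp at h
      linear_combination sin δ * h
    have g3 : (ellipseSpeed a b s)⁻¹ * (√(A ^ 2 - a ^ 2) / (A * B) * ellipseSpeed a b s) =
        (ellipseSpeed a b (s + 2 * δ))⁻¹ *
          (√(A ^ 2 - a ^ 2) / (A * B) * ellipseSpeed a b (s + 2 * δ)) := by
      field_simp
    linear_combination (ellipseSpeed a b s)⁻¹ * g1 + (ellipseSpeed a b (s + 2 * δ))⁻¹ * g2 + g3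

omit N in
lemma unitDirection_of_eq_smul (ha : a ≠ 0) (hb : b ≠ 0) {x y : Plane} {μ s : ℝ} (hμ : 0 < μ)
    (h : y - x = μ • ellipseVelocity e a b s) :
    unitDirection x y = (ellipseSpeed a b s)⁻¹ • ellipseVelocity e a b s := by
  have := (ellipseSpeed_pos ha hb s).ne'
  rw [unitDirection, h, norm_smul, norm_ellipseVelocity, Real.norm_of_nonneg hμ.le, smul_smul]
  congr 1
  field_simp

variable {c : ℝ} (E : EllipseAxes c a b) (E' : EllipseAxes c A B)
  {o : Orientation ℝ Plane (Fin 2)} (ho : 0 < b * o.areaForm (e 0) (e 1))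

omit N in
include E' in
lemma add_smul_velocity_mem_iff {s r : ℝ} :
    ellipsePoint C e a b s + r • ellipseVelocity e a b s ∈ framedEllipse C e c A ↔
      a ^ 2 / A ^ 2 * (cos s - r * sin s) ^ 2 + b ^ 2 / B ^ 2 * (sin s + r * cos s) ^ 2 = 1 := by
  rw [ellipsePoint_add_smul_velocity, E'.mem_ellipse_iff]
  ring_nf

include E E' ho

lemma exists_trajectory (s : ℝ) : ∃ x y z, IsBilliardTrajectory (framedEllipse C e c A) x y z ∧
    IsPositivelyTangentAt o (framedEllipse C e c a) x y (ellipsePoint C e a b s) := by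
  have hmem := @add_smul_velocity_mem_iff C e a b A B c E'
  have key := exists_tangent_line_meet N.ratio_pos N.ratio_lt_one N.ratio_pos' N.ratio_lt_one'
  have hsign := fun s => @neg_and_pos_of_tangent_line _ _ s N.ratio_pos N.ratio_lt_one N.ratio_pos'
    N.ratio_lt_one'
  obtain ⟨r, r', hlt, h, h'⟩ := key s
  have hr' := (hsign s hlt h h').2
  have hδ0 := arctan_pos.2 hr'
  have hδ1 := arctan_lt_pi_div_two r'
  obtain ⟨δ, hδ⟩ : ∃ δ, δ = arctan r' := ⟨_, rfl⟩
  rw [← hδ] at hδ0 hδ1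
  obtain rfl : r' = tan δ := by rw [hδ, tan_arctan]
  have hs := sin_pos_of_pos_of_lt_pi hδ0 (by linarith [pi_pos])
  have hc := cos_pos_of_mem_Ioo ⟨by linarith, hδ1⟩
  -- On the reflected line `y` has parameter `-tan δ < 0`; the positive root `r₂` supplies `z` ahead
  -- of it.
  obtain ⟨r₁, r₂, hlt₂, h₁, h₂⟩ := key (s + 2 * δ)
  have hr₂ := (hsign _ hlt₂ h₁ h₂).2
  have hd : ellipsePoint C e a b s + tan δ • ellipseVelocity e a b s -
      (ellipsePoint C e a b s + r • ellipseVelocity e a b s) =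
        (tan δ - r) • ellipseVelocity e a b s := by module
  have hd' : ellipsePoint C e a b (s + 2 * δ) + r₂ • ellipseVelocity e a b (s + 2 * δ) -
      (ellipsePoint C e a b s + tan δ • ellipseVelocity e a b s) =
        (r₂ + tan δ) • ellipseVelocity e a b (s + 2 * δ) := by
    rw [← ellipsePoint_sub_tan_smul s hc]
    module
  have hne : ellipsePoint C e a b s + r • ellipseVelocity e a b s ≠
      ellipsePoint C e a b s + tan δ • ellipseVelocity e a b s := by
    rw [ne_comm, ← sub_ne_zero, hd]
    exact smul_ne_zero (sub_pos.2 hlt).ne' (E.velocity_ne_zero s)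
  refine ⟨_, _, _, ⟨hmem.2 h, hmem.2 h', hmem.2 h₂, hne, ?_, ?_⟩,
    (E.isPositivelyTangentAt_iff ho hne).2 ⟨r, _, hlt, rfl, rfl⟩⟩
  · rw [ne_comm, ← sub_ne_zero, hd']
    exact smul_ne_zero (by positivity) (E.velocity_ne_zero _)
  · rw [unitDirection_of_eq_smul E.pos.ne' E.ne_zero (by positivity) hd',
      unitDirection_of_eq_smul E.pos.ne' E.ne_zero (sub_pos.2 hlt) hd,
      N.reflection_velocity E' hs hc (meetAt_of_mem hc h')]

/-- The billiard map of the outer ellipse translates the invariant length on the inner one. -/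
theorem exists_shift : ∃ k : ℝ, ∀ (s : ℝ) (x y z : Plane),
    IsBilliardTrajectory (framedEllipse C e c A) x y z →
    IsPositivelyTangentAt o (framedEllipse C e c a) x y (ellipsePoint C e a b s) →
    ∃ t, ellipseArc a b t = ellipseArc a b s + k ∧
      IsPositivelyTangentAt o (framedEllipse C e c a) y z (ellipsePoint C e a b t) := by
  obtain ⟨k, hk⟩ := N.exists_arc_const
  refine ⟨k, fun s x y z htr htan => ?_⟩
  obtain ⟨r, r', hlt, rfl, rfl⟩ := (E.isPositivelyTangentAt_iff ho htr.left_ne).1 htan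
  have h := (add_smul_velocity_mem_iff E').1 htr.left_mem
  have h' := (add_smul_velocity_mem_iff E').1 htr.mid_mem
  have hr' := (neg_and_pos_of_tangent_line N.ratio_pos N.ratio_lt_one N.ratio_pos' N.ratio_lt_one'
    hlt h h').2
  have hδ0 := arctan_pos.2 hr'
  have hδ1 := arctan_lt_pi_div_two r'
  obtain ⟨δ, hδ⟩ : ∃ δ, δ = arctan r' := ⟨_, rfl⟩
  rw [← hδ] at hδ0 hδ1
  obtain rfl : r' = tan δ := by rw [hδ, tan_arctan]
  have hs := sin_pos_of_pos_of_lt_pi hδ0 (by linarith [pi_pos])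
  have hc := cos_pos_of_mem_Ioo ⟨by linarith, hδ1⟩
  have hmeet := meetAt_of_mem hc h'
  refine ⟨s + 2 * δ, hk s δ hδ0 hδ1 hmeet, ?_⟩
  -- The law forces `z - y` to be a positive multiple of the velocity at `s + 2 * δ`, and `y`
  -- already lies on that tangent line.
  have hlaw := htr.reflection_law
  have hd : ellipsePoint C e a b s + tan δ • ellipseVelocity e a b s -
      (ellipsePoint C e a b s + r • ellipseVelocity e a b s) =
        (tan δ - r) • ellipseVelocity e a b s := by module
  rw [unitDirection_of_eq_smul E.pos.ne' E.ne_zero (sub_pos.2 hlt) hd,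
    N.reflection_velocity E' hs hc hmeet, unitDirection] at hlaw
  set y := ellipsePoint C e a b s + tan δ • ellipseVelocity e a b s with hy
  have hyz := htr.right_ne
  have hn : 0 < ‖z - y‖ := norm_pos_iff.2 (sub_ne_zero.2 hyz.symm)
  have hw := ellipseSpeed_pos E.pos.ne' E.ne_zero (s + 2 * δ)
  have hz : z - y = (‖z - y‖ * (ellipseSpeed a b (s + 2 * δ))⁻¹) •
      ellipseVelocity e a b (s + 2 * δ) := by
    rw [mul_smul, ← hlaw, smul_smul, mul_inv_cancel₀ hn.ne', one_smul]
  rw [← ellipsePoint_sub_tan_smul s hc] at hy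
  refine (E.isPositivelyTangentAt_iff ho hyz).2 ⟨-tan δ,
    -tan δ + ‖z - y‖ * (ellipseSpeed a b (s + 2 * δ))⁻¹, ?_, hy, ?_⟩
  · have : 0 < ‖z - y‖ * (ellipseSpeed a b (s + 2 * δ))⁻¹ := by positivity
    linarith
  · rw [add_smul, ← add_assoc, ← hy, ← hz]
    abel

end NestedAxes

/-! ### The cyclic coordinate. -/

lemma exists_addCircle_homeomorph {Y : Type*} [TopologicalSpace Y] [T2Space Y] {P : ℝ} (hP : 0 < P)
    {f : ℝ → Y} (hf : Continuous f) (hper : Function.Periodic f P) (hsurj : Function.Surjective f)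
    (hinj : ∀ s t, f s = f t → (s : AddCircle P) = t) :
    ∃ φ : AddCircle P ≃ₜ Y, ∀ s : ℝ, φ s = f s := by
  have : Fact (0 < P) := ⟨hP⟩
  have hc : Continuous hper.lift := continuous_coinduced_dom.2 hf
  have hb : Function.Bijective hper.lift := by
    constructor
    · intro u v h
      induction u using QuotientAddGroup.induction_on with | H s => ?_
      induction v using QuotientAddGroup.induction_on with | H t => ?_
      exact hinj s t h
    · intro y
      obtain ⟨s, hs⟩ := hsurj y
      exact ⟨s, hs⟩
  exact ⟨Continuous.homeoOfEquivCompactToT2 (f := Equiv.ofBijective _ hb) hc, fun s => rfl⟩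

namespace EllipseAxes

variable {c a b : ℝ} (E : EllipseAxes c a b)
  (C : Plane) (e : OrthonormalBasis (Fin 2) ℝ Plane)

/-- An ellipse has a cyclic coordinate proportional to the invariant length. -/
theorem exists_cyclic_coordinate (E : EllipseAxes c a b) :
    ∃ x : framedEllipse C e c a ≃ₜ UnitAddCircle, ∀ s : ℝ,
      x ⟨ellipsePoint C e a b s, E.ellipsePoint_mem C e s⟩ =
        ((ellipseArc a b s / ellipseArc a b (2 * π) : ℝ) : UnitAddCircle) := by
  have ha := E.pos.ne'
  have hb := E.ne_zero
  have hI := ellipseArc_period_pos ha hb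
  obtain ⟨φ, hφ⟩ := exists_addCircle_homeomorph (Y := framedEllipse C e c a) two_pi_pos
    (f := fun s => ⟨ellipsePoint C e a b s, E.ellipsePoint_mem C e s⟩)
    (Continuous.subtype_mk (continuous_iff_continuousAt.2 fun s =>
      (hasDerivAt_ellipsePoint C e s).continuousAt) _)
    (fun s => Subtype.ext (ellipsePoint_eq_of_cos_sub C e (by simp)))
    (fun y => by
      obtain ⟨s, hs⟩ := E.exists_eq_ellipsePoint C e y.2
      exact ⟨s, Subtype.ext hs.symm⟩)
    (fun s t h => by
      have h1 := frameVec_inj e (add_left_cancel (Subtype.ext_iff.1 h))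
      exact Real.Angle.cos_sin_inj (mul_left_cancel₀ ha h1.1) (mul_left_cancel₀ hb h1.2))
  have hper : ∀ s, ellipseArc a b (s + 2 * π) / ellipseArc a b (2 * π) =
      ellipseArc a b s / ellipseArc a b (2 * π) + 1 := fun s => by
    rw [ellipseArc_add_period ha hb, add_div, div_self hI.ne']
  have hcont := (continuous_ellipseArc ha hb).div_const (ellipseArc a b (2 * π))
  obtain ⟨ψ, hψ⟩ := exists_addCircle_homeomorph (Y := UnitAddCircle) two_pi_pos
    (f := fun s => ((ellipseArc a b s / ellipseArc a b (2 * π) : ℝ) : UnitAddCircle))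
    ((AddCircle.continuous_mk' 1).comp hcont)
    (fun s => by
      simp only [hper s]
      exact AddCircle.coe_add_period 1 _)
    (fun y => by
      obtain ⟨u, hu, rfl⟩ := AddCircle.coe_image_Icc_eq (1 : ℝ) 0 |>.symm ▸ Set.mem_univ y
      rw [zero_add] at hu
      obtain ⟨s, -, hs⟩ := intermediate_value_Icc two_pi_pos.le hcont.continuousOn
        (show u ∈ Set.Icc (ellipseArc a b 0 / ellipseArc a b (2 * π))
          (ellipseArc a b (2 * π) / ellipseArc a b (2 * π)) by
            rwa [ellipseArc_zero, zero_div, div_self hI.ne'])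
      exact ⟨s, congrArg _ hs⟩)
    (fun s t h => by
      -- Normalized length and `s / (2π)` both grow by one per turn. Thus lengths that differ by `n`
      -- belong to parameters that differ by `n` turns, by strict monotonicity.
      have hp : Function.Periodic
          (fun s => ellipseArc a b s / ellipseArc a b (2 * π) - s / (2 * π)) (2 * π) := fun s => by
        simp only
        rw [hper s, add_div, div_self two_pi_pos.ne']
        ring
      rw [← sub_eq_zero, ← AddCircle.coe_sub, AddCircle.coe_eq_zero_iff] at h
      obtain ⟨n, hn⟩ := h
      have h1 := hp.int_mul n t
      simp only [zsmul_eq_mul, mul_one] at hn h1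
      rw [add_div, mul_div_cancel_right₀ _ two_pi_pos.ne'] at h1
      have h2 : ellipseArc a b s = ellipseArc a b (t + n * (2 * π)) :=
        (div_left_inj' hI.ne').1 (by linarith)
      rw [(strictMono_ellipseArc ha hb).injective h2, ← sub_eq_zero, ← AddCircle.coe_sub,
        AddCircle.coe_eq_zero_iff]
      exact ⟨n, by rw [zsmul_eq_mul, add_sub_cancel_left]⟩)
  refine ⟨φ.symm.trans ψ, fun s => ?_⟩
  rw [Homeomorph.trans_apply, ← hφ, Homeomorph.symm_apply_apply, hψ]

variable {C e} {o : Orientation ℝ Plane (Fin 2)} (ho : 0 < b * o.areaForm (e 0) (e 1))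
include E ho

/-- The billiard ball maps of the confocal outer ellipses are the translations by certain
constants in the cyclic coordinate. -/
theorem exists_isBilliardBallMap_iff (x : framedEllipse C e c a ≃ₜ UnitAddCircle)
    (hx : ∀ s : ℝ, x ⟨ellipsePoint C e a b s, E.ellipsePoint_mem C e s⟩ =
      ((ellipseArc a b s / ellipseArc a b (2 * π) : ℝ) : UnitAddCircle))
    {A : ℝ} (hA : a < A) :
    ∃ k : UnitAddCircle, ∀ T : framedEllipse C e c a → framedEllipse C e c a,
      IsBilliardBallMap o (framedEllipse C e c a) (framedEllipse C e c A) T ↔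
        ∀ p, x (T p) = x p + k := by
  have hlt := E.lt.trans hA
  have hpos : 0 < A ^ 2 - c ^ 2 := sub_pos.2 (pow_lt_pow_left₀ hlt E.nonneg two_ne_zero)
  have hsq := sq_sqrt hpos.le
  have E' : EllipseAxes c A (√(A ^ 2 - c ^ 2)) := ⟨E.nonneg, hlt, hsq⟩
  have N : NestedAxes a b A (√(A ^ 2 - c ^ 2)) :=
    ⟨E.pos, E.ne_zero, hA, sqrt_pos.2 hpos, by linarith [E.sq_eq]⟩
  obtain ⟨k, hk⟩ := N.exists_shift (C := C) E E' ho
  have hshift : ∀ s t, ellipseArc a b t = ellipseArc a b s + k →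
      x ⟨ellipsePoint C e a b t, E.ellipsePoint_mem C e t⟩ =
        x ⟨ellipsePoint C e a b s, E.ellipsePoint_mem C e s⟩ +
          ((k / ellipseArc a b (2 * π) : ℝ) : UnitAddCircle) := fun s t h => by
    rw [hx, hx, h, add_div, AddCircle.coe_add]
  refine ⟨((k / ellipseArc a b (2 * π) : ℝ) : UnitAddCircle), fun T => ⟨fun hT p => ?_, fun hT => ?_⟩⟩
  -- A trajectory exists along the tangent line at `p`, and its reflected line touches the inner
  -- ellipse at one point only; this pins down `T p`.
  · obtain ⟨y₁, y₂, y₃, htr, htan⟩ := hT.exists_trajectory p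
    have h1 := hT.map_tangency p _ _ _ htr htan
    obtain ⟨p, hp⟩ := p
    obtain ⟨s, rfl⟩ := E.exists_eq_ellipsePoint C e hp
    obtain ⟨t, ht, h2⟩ := hk s _ _ _ htr htan
    rw [← hshift s t ht]
    exact congrArg x (Subtype.ext (E.eq_of_isPositivelyTangentAt ho htr.right_ne h1 h2))
  · constructor
    · rintro ⟨p, hp⟩
      obtain ⟨s, rfl⟩ := E.exists_eq_ellipsePoint C e hp
      exact N.exists_trajectory E E' ho s
    · rintro ⟨p, hp⟩ y₁ y₂ y₃ htr htan
      obtain ⟨s, rfl⟩ := E.exists_eq_ellipsePoint C e hp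
      obtain ⟨t, ht, h2⟩ := hk s _ _ _ htr htan
      have h3 := hT ⟨_, hp⟩
      rw [← hshift s t ht] at h3
      rwa [x.injective h3]

omit ho in
/-- There is a cyclic coordinate on an ellipse, independent of the orientation of the plane, in
which all billiard ball maps of confocal outer ellipses are translations. -/
theorem exists_linearizing_coordinate :
    ∃ x : framedEllipse C e c a ≃ₜ UnitAddCircle,
      ∀ (o : Orientation ℝ Plane (Fin 2)) (A : ℝ), a < A →
        ∃ k : UnitAddCircle, ∀ T : framedEllipse C e c a → framedEllipse C e c a,
          IsBilliardBallMap o (framedEllipse C e c a) (framedEllipse C e c A) T ↔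
            ∀ p, x (T p) = x p + k := by
  obtain ⟨x, hx⟩ := E.exists_cyclic_coordinate C e
  refine ⟨x, fun o A hA => ?_⟩
  -- For the opposite orientation `-b` replaces `b`, which reverses the traversal. The invariant
  -- length is odd, so the shift by `k` in the coordinate `-x` is the shift by `-k` in `x`.
  rcases (mul_ne_zero E.ne_zero (areaForm_basis_ne_zero e o)).lt_or_gt with ho | ho
  · obtain ⟨k, hk⟩ := E.neg.exists_isBilliardBallMap_iff (o := o) (by linarith)
      (x.trans (Homeomorph.neg UnitAddCircle)) (fun s => by
        have h1 : (⟨ellipsePoint C e a (-b) s, E.neg.ellipsePoint_mem C e s⟩ :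
            framedEllipse C e c a) =
            ⟨ellipsePoint C e a b (-s), E.ellipsePoint_mem C e (-s)⟩ :=
          Subtype.ext (by simp [ellipsePoint])
        rw [Homeomorph.trans_apply, h1, hx, ellipseArc_neg, ellipseArc_neg_right,
          ellipseArc_neg_right, neg_div, AddCircle.coe_neg, Homeomorph.coe_neg, neg_neg]) hA
    refine ⟨-k, fun T => (hk T).trans (forall_congr' fun p => ?_)⟩
    simp only [Homeomorph.trans_apply, Homeomorph.coe_neg]
    rw [neg_eq_iff_eq_neg, neg_add, neg_neg]
  · exact E.exists_isBilliardBallMap_iff ho x hx hA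

end EllipseAxes

/-! ### Choice of a frame from the foci, and the theorem. -/

lemma exists_orthonormalBasis_smul_eq (w : Plane) :
    ∃ e : OrthonormalBasis (Fin 2) ℝ Plane, w = ‖w‖ • e 0 := by
  rcases eq_or_ne w 0 with rfl | hw
  · exact ⟨EuclideanSpace.basisFun (Fin 2) ℝ, by simp⟩
  · have hv : Orthonormal ℝ (({0} : Set (Fin 2)).domRestrict fun _ => ‖w‖⁻¹ • w) := by
      refine ⟨fun _ => ?_, fun i j hij => (hij (Subsingleton.elim i j)).elim⟩
      simp [norm_smul, hw]
    obtain ⟨e, he⟩ := hv.exists_orthonormalBasis_extension_of_card_eq (by simp)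
    refine ⟨e, ?_⟩
    rw [he 0 rfl, smul_smul, mul_inv_cancel₀ (norm_ne_zero_iff.2 hw), one_smul]

lemma exists_frame (F₁ F₂ : Plane) : ∃ (C : Plane) (e : OrthonormalBasis (Fin 2) ℝ Plane),
    F₁ = C + frameVec e (-(dist F₁ F₂ / 2)) 0 ∧ F₂ = C + frameVec e (dist F₁ F₂ / 2) 0 := by
  obtain ⟨e, he⟩ := exists_orthonormalBasis_smul_eq (F₂ - F₁)
  rw [← dist_eq_norm, dist_comm] at he
  have h : frameVec e (dist F₁ F₂ / 2) 0 = (1 / 2 : ℝ) • (F₂ - F₁) := by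
    rw [he, frameVec]
    module
  have h' : frameVec e (-(dist F₁ F₂ / 2)) 0 = (-1 / 2 : ℝ) • (F₂ - F₁) := by
    rw [he, frameVec]
    module
  refine ⟨(1 / 2 : ℝ) • (F₁ + F₂), e, ?_, ?_⟩
  · rw [h']
    module
  · rw [h]
    module

theorem corollary5 (F₁ F₂ : Plane) (ℓ : ℝ) (hℓ : dist F₁ F₂ < ℓ) :
    ∃ x : ellipse F₁ F₂ ℓ ≃ₜ UnitAddCircle,
      ∀ o : Orientation ℝ Plane (Fin 2),
        (∀ L : ℝ, ellipse F₁ F₂ ℓ ⊆ ellipseInterior F₁ F₂ L →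
          (∃! T : ellipse F₁ F₂ ℓ → ellipse F₁ F₂ ℓ,
            IsBilliardBallMap o (ellipse F₁ F₂ ℓ) (ellipse F₁ F₂ L) T) ∧
          (∀ T : ellipse F₁ F₂ ℓ → ellipse F₁ F₂ ℓ,
            IsBilliardBallMap o (ellipse F₁ F₂ ℓ) (ellipse F₁ F₂ L) T →
            ∃ c : UnitAddCircle, ∀ p : ellipse F₁ F₂ ℓ, x (T p) = x p + c)) ∧
        (∀ L L' : ℝ, ellipse F₁ F₂ ℓ ⊆ ellipseInterior F₁ F₂ L →
          ellipse F₁ F₂ ℓ ⊆ ellipseInterior F₁ F₂ L' →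
          ∀ T T' : ellipse F₁ F₂ ℓ → ellipse F₁ F₂ ℓ,
            IsBilliardBallMap o (ellipse F₁ F₂ ℓ) (ellipse F₁ F₂ L) T →
            IsBilliardBallMap o (ellipse F₁ F₂ ℓ) (ellipse F₁ F₂ L') T' →
            T ∘ T' = T' ∘ T) := by
  -- Characterizing billiard ball maps as exactly the shifts by `k` gives existence, uniqueness,
  -- linearization and commutation at once.
  obtain ⟨x, hx⟩ : ∃ x : ellipse F₁ F₂ ℓ ≃ₜ UnitAddCircle,
      ∀ (o : Orientation ℝ Plane (Fin 2)) (L : ℝ), ellipse F₁ F₂ ℓ ⊆ ellipseInterior F₁ F₂ L →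
        ∃ k : UnitAddCircle, ∀ T : ellipse F₁ F₂ ℓ → ellipse F₁ F₂ ℓ,
          IsBilliardBallMap o (ellipse F₁ F₂ ℓ) (ellipse F₁ F₂ L) T ↔
            ∀ p, x (T p) = x p + k := by
    obtain ⟨C, e, h₁, h₂⟩ := exists_frame F₁ F₂
    have hc : 0 ≤ dist F₁ F₂ / 2 := by positivity
    generalize hcd : dist F₁ F₂ / 2 = c at *
    obtain ⟨a, rfl⟩ : ∃ a, ℓ = 2 * a := ⟨ℓ / 2, by ring⟩
    have hca : c < a := by linarith
    have E : EllipseAxes c a (√(a ^ 2 - c ^ 2)) :=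
      ⟨hc, hca, sq_sqrt (sub_nonneg.2 (pow_le_pow_left₀ hc hca.le 2))⟩
    obtain ⟨x, hx⟩ := E.exists_linearizing_coordinate (C := C) (e := e)
    rw [h₁, h₂]
    refine ⟨x, fun o L hL => ?_⟩
    obtain ⟨A, rfl⟩ : ∃ A, L = 2 * A := ⟨L / 2, by ring⟩
    -- One point of the inner ellipse suffices to turn the inclusion into `a < A`.
    have hmem := E.ellipsePoint_mem C e 0
    have h1 := hL hmem
    refine hx o A ?_
    rw [framedEllipse, ellipse, Set.mem_ofPred_eq] at hmem
    rw [ellipseInterior, Set.mem_ofPred_eq, hmem] at h1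
    linarith
  refine ⟨x, fun o => ⟨fun L hL => ?_, fun L L' hL hL' T T' hT hT' => ?_⟩⟩
  · obtain ⟨k, hk⟩ := hx o L hL
    refine ⟨⟨fun p => x.symm (x p + k), (hk _).2 fun p => x.apply_symm_apply _, fun T hT => ?_⟩,
      fun T hT => ⟨k, (hk T).1 hT⟩⟩
    funext p
    rw [← (hk T).1 hT p, x.symm_apply_apply]
  · obtain ⟨k, hk⟩ := hx o L hL
    obtain ⟨k', hk'⟩ := hx o L' hL'
    have h := (hk T).1 hT
    have h' := (hk' T').1 hT'
    funext p
    apply x.injective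
    rw [Function.comp_apply, Function.comp_apply, h, h', h', h, add_right_comm]
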